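/- Let $(K,\delta)$ be a differentially closed field of characteristic $0$, and let $V$ be a smooth variety over $K$, i.e. an irreducible (integral), separated, smooth scheme of finite type over $K$, of dimension $n$. For a $K$-point $p$ of $V$ let $TV_p$ be its tangent space and let $\tau V_p$ be the fibre over $p$ of the first prolongation of $V$, an affine space under $TV_p$: if $V\subseteq K^N$ is affine with $I(V)=\langle p_1,\dots,p_m\rangle$ and $a\in V$, then $$\tau V_a=\Big\{u\in K^N:\ \sum_{i}\frac{\partial p_j}{\partial x_i}(a)\,u_i+p_j^{\delta}(a)=0,\ j=1,\dots,m\Big\},$$ where $p^\delta$ is $p$ with $\delta$ applied to its coefficients; in a coordinate-free way, $\tau V_p$ is the set of derivations $D:\mathcal O_{V,p}\to K$ (with $K$ an $\mathcal O_{V,p}$-module by evaluation at $p$) such that $D|_K=\delta$, and $TV_p$ is the space of those with $D|_K=0$. For $U\subseteq V$ open let $\Psi[U]$ be the $K[U]$-module of all functions $\psi$ mapping each $K$-point $p\in U$ to an affine map $\psi(p):\tau V_p\to K$, where $K[U]=\mathcal O_V(U)$ acts by $(g\psi)(p)=g(p)\psi(p)$. For $f\in K[U]$ let $\tau f\in\Psi[U]$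 be given by $(\tau f)(p)(D)=D(f)$; in coordinates, $(\tau f)(a)(u)=df_a(u)+f^\delta(a)$. A regular $\tau$-form on $U$ is a $\psi\in\Psi[U]$ such that every point of $U$ has an open neighbourhood $W\subseteq U$ for which $\psi|_W$ lies in the $K[W]$-submodule of $\Psi[W]$ generated by the elements $\tau f$, $f\in K[W]$. The regular $\tau$-forms on $U$ form a $K[U]$-module $\Omega^\tau[U]$. A rational $\tau$-form on $V$ is an equivalence class of regular $\tau$-forms on nonempty open subsets of $V$, two of them being equivalent if they agree on some nonempty open subset of both domains; the rational $\tau$-forms form a vector space $\Omega^\tau(V)$ over the field $K(V)$ of rational functions on $V$. Then: (1) every point of $V$ has an affine open neighbourhood $U$ such that $\Omega^\tau[U]$ is a free $K[U]$-module of rank $n+1$; (2) $\Omega^\tau(V)$ is a vector space of dimension $n+1$ over $K(V)$. -/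

import Mathlib

open AlgebraicGeometry

universe u

noncomputable section

namespace TauForms

open CategoryTheory Opposite
open scoped Differential

/-! ### Differentially closed fields -/

section DifferentialFields

variable (K : Type u) [Field K] [Differential K]

/-- Differential polynomials in one differential indeterminate `X` over `K`; the variable with
index `i` stands for the `i`-th derivative of `X`. -/
abbrev DiffPoly : Type u := MvPolynomial ℕ K

variable {K}

/-- The value at `a` of a differential polynomial: the `i`-th derivative of `a` is substituted for
the variable with index `i`. -/
def DiffPoly.evalAt (f : DiffPoly K) (a : K) : K :=
  MvPolynomial.eval (fun i => (fun b : K => b′)^[i] a) f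

/-- The order of a differential polynomial: the largest index of a variable which occurs in it,
and `⊥` for the elements of `K`. -/
def DiffPoly.order (f : DiffPoly K) : WithBot ℕ := f.vars.max

variable (K)

/-- Blum's axioms: a differential field (of characteristic zero) is differentially closed if for
all differential polynomials `f` and `g ≠ 0` in one indeterminate with `ord g < ord f` there is
`a` with `f(a) = 0` and `g(a) ≠ 0`. -/
class IsDifferentiallyClosed : Prop extends CharZero K where
  exists_root : ∀ f g : DiffPoly K, g ≠ 0 → g.order < f.order →
    ∃ a : K, f.evalAt a = 0 ∧ g.evalAt a ≠ 0

end DifferentialFields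

/-! ### Points, tangent spaces and fibres of the prolongation -/

variable (K : Type u) [Field K] (V : Scheme.{u}) [V.Over (Spec (.of K))]

/-- The points of the variety `V` with coordinates in `K`: sections of the structure morphism. -/
structure KPoint : Type u where
  hom : Spec (.of K) ⟶ V
  isSection : hom ≫ (V ↘ Spec (.of K)) = 𝟙 _

variable {V} in
/-- The elements of `K` as constant germs of functions at `x`. -/
def constGerm (x : V) : K →+* V.presheaf.stalk x :=
  ((Scheme.ΓSpecIso (.of K)).inv ≫ (V ↘ Spec (.of K)).appTop ≫
    V.presheaf.germ ⊤ x (TopologicalSpace.Opens.mem_top x)).hom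

variable {K V}

namespace KPoint

/-- The point of the underlying space of `V` given by a `K`-point. -/
abbrev pt (p : KPoint K V) : V := p.hom (IsLocalRing.closedPoint K)

/-- The local ring of `V` at `p`. -/
abbrev Loc (p : KPoint K V) : CommRingCat.{u} := V.presheaf.stalk p.pt

/-- The value at `p` of a germ of a function. -/
def evalGerm (p : KPoint K V) : p.Loc →+* K := (Scheme.stalkClosedPointTo p.hom).hom

/-- The germ at `p` of a function on an open set containing `p`. -/
def germ (p : KPoint K V) {U : V.Opens} (hp : p.pt ∈ U) : Γ(V, U) →+* p.Loc :=
  (V.presheaf.germ U p.pt hp).hom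

/-- The value at `p` of a function on an open set containing `p`. -/
def eval (p : KPoint K V) {U : V.Opens} (hp : p.pt ∈ U) : Γ(V, U) →+* K :=
  p.evalGerm.comp (p.germ hp)

/-- `K` as a module (algebra) over the local ring at `p`, through evaluation at `p`. -/
instance (p : KPoint K V) : Algebra p.Loc K := p.evalGerm.toAlgebra

instance (p : KPoint K V) : SMulCommClass K p.Loc K := SMulCommClass.symm _ _ _

/-- The tangent space `TV_p`: derivations `D : 𝒪_{V,p} → K` at `p`, that is, additive maps with
`D (f g) = f(p) D g + g(p) D f`, which vanish on `K`. In coordinates on an affine neighbourhood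
`V ⊆ Kⁿ` with `I(V) = (p₁, …, pₘ)`, `D ↦ u = (D x₁, …, D xₙ)` identifies this with the set of `u`
such that `∑ᵢ ∂pⱼ/∂xᵢ(a) uᵢ = 0` for all `j`. -/
def TangentFiber (p : KPoint K V) : Submodule K (Derivation ℤ p.Loc K) where
  carrier := {D | ∀ c : K, D (constGerm K p.pt c) = 0}
  add_mem' := by
    intro D E hD hE c
    rw [Derivation.add_apply, hD c, hE c, add_zero]
  zero_mem' := fun _ => rfl
  smul_mem' := by
    intro a D hD c
    rw [Derivation.smul_apply, hD c, smul_zero]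

variable [Differential K]

/-- The fibre `τV_p` of the first prolongation: derivations `D : 𝒪_{V,p} → K` at `p` which extend
the derivation of `K`. In coordinates on an affine neighbourhood `V ⊆ Kⁿ` with
`I(V) = (p₁, …, pₘ)`, `D ↦ u = (D x₁, …, D xₙ)` identifies this with the set of `u` such that
`∑ᵢ ∂pⱼ/∂xᵢ(a) uᵢ + pⱼ^δ(a) = 0` for all `j`. -/
@[ext]
structure ProlFiber (p : KPoint K V) : Type u where
  der : Derivation ℤ p.Loc K
  der_const : ∀ c : K, der (constGerm K p.pt c) = c′

/-- The action of the vector space `TV_p` on `τV_p` by translation. -/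
instance (p : KPoint K V) : AddAction p.TangentFiber p.ProlFiber where
  vadd t D := ⟨t.1 + D.der, fun c => by rw [Derivation.add_apply, t.2 c, D.der_const c, zero_add]⟩
  zero_vadd D := ProlFiber.ext (zero_add D.der)
  add_vadd s t D := ProlFiber.ext (add_assoc s.1 t.1 D.der)

/-- The action of `TV_p` on `τV_p` is regular: any two elements differ by a unique vector. -/
theorem existsUnique_vadd_eq (p : KPoint K V) (D E : p.ProlFiber) :
    ∃! t : p.TangentFiber, t +ᵥ D = E := by
  refine ⟨⟨E.der - D.der, fun c => by rw [Derivation.sub_apply, E.der_const c, D.der_const c, sub_self]⟩,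
    ProlFiber.ext (sub_add_cancel E.der D.der), ?_⟩
  rintro t rfl
  exact Subtype.ext (add_sub_cancel_right t.1 D.der).symm

/-- The affine maps `τV_p → K`: those `f` for which there is a linear map `L : TV_p → K` with
`f (t + D) = L t + f D`. -/
def AffineFun (p : KPoint K V) : Submodule K (p.ProlFiber → K) where
  carrier := {f | ∃ L : p.TangentFiber →ₗ[K] K,
    ∀ (t : p.TangentFiber) (D : p.ProlFiber), f (t +ᵥ D) = L t + f D}
  add_mem' := by
    rintro f g ⟨L, hL⟩ ⟨M, hM⟩
    refine ⟨L + M, fun t D => ?_⟩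
    simp only [Pi.add_apply, LinearMap.add_apply, hL, hM]
    ring
  zero_mem' := ⟨0, fun t D => by simp⟩
  smul_mem' := by
    rintro a f ⟨L, hL⟩
    refine ⟨a • L, fun t D => ?_⟩
    simp only [Pi.smul_apply, LinearMap.smul_apply, hL, smul_add]

/-- The affine map `D ↦ D f` on `τV_p` given by the germ of a function `f`; in coordinates it is
`u ↦ df_a(u) + f^δ(a)`. -/
def tauGerm (p : KPoint K V) (f : p.Loc) : p.AffineFun :=
  ⟨fun D => D.der f,
    { toFun := fun t => t.1 f
      map_add' := fun _ _ => rfl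
      map_smul' := fun _ _ => rfl }, fun _ _ => rfl⟩

end KPoint

/-! ### Regular `τ`-forms -/

section Regular

/-- Restriction of functions in `K[U]` to an open set `W ⊆ U`. -/
def resFun {U W : V.Opens} (h : W ≤ U) : Γ(V, U) →+* Γ(V, W) :=
  (V.presheaf.map (homOfLE h).op).hom

theorem eval_resFun {U W : V.Opens} (h : W ≤ U) (p : KPoint K V) (hp : p.pt ∈ W) (g : Γ(V, U)) :
    p.eval hp (resFun h g) = p.eval (h hp) g :=
  congrArg p.evalGerm (TopCat.Presheaf.germ_res_apply V.presheaf (homOfLE h) p.pt hp g)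

variable [Differential K]

variable (K) in
/-- `Ψ[U]`: the functions which map each point `p` of `U` to an affine map `τV_p → K`. -/
def Psi (U : V.Opens) : Type u := ∀ p : {p : KPoint K V // p.pt ∈ U}, p.1.AffineFun

instance (U : V.Opens) : AddCommGroup (Psi K U) :=
  inferInstanceAs (AddCommGroup (∀ p : {p : KPoint K V // p.pt ∈ U}, p.1.AffineFun))

/-- `Ψ[U]` is a `K[U]`-module by `(g ψ)(p) = g(p) ψ(p)`. -/
instance (U : V.Opens) : Module Γ(V, U) (Psi K U) where
  smul g ψ := fun p => p.1.eval p.2 g • ψ p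
  one_smul ψ := funext fun p => by
    change p.1.eval p.2 1 • ψ p = ψ p
    rw [map_one, one_smul]
  mul_smul g h ψ := funext fun p => by
    change p.1.eval p.2 (g * h) • ψ p = p.1.eval p.2 g • p.1.eval p.2 h • ψ p
    rw [map_mul, mul_smul]
  smul_zero g := funext fun p => smul_zero (p.1.eval p.2 g)
  smul_add g ψ φ := funext fun p => smul_add (p.1.eval p.2 g) (ψ p) (φ p)
  add_smul g h ψ := funext fun p => by
    change p.1.eval p.2 (g + h) • ψ p = p.1.eval p.2 g • ψ p + p.1.eval p.2 h • ψ p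
    rw [map_add, add_smul]
  zero_smul ψ := funext fun p => by
    change p.1.eval p.2 0 • ψ p = 0
    rw [map_zero, zero_smul]

/-- Restriction of elements of `Ψ[U]` to an open set `W ⊆ U`; it is additive, and semilinear over
the restriction of functions. -/
def Psi.res {U W : V.Opens} (h : W ≤ U) : Psi K U →ₛₗ[resFun h] Psi K W where
  toFun ψ := fun p => ψ ⟨p.1, h p.2⟩
  map_add' _ _ := rfl
  map_smul' g ψ := funext fun p =>
    congrArg (· • ψ ⟨p.1, h p.2⟩) (eval_resFun h p.1 p.2 g).symm

variable (K) in
/-- The `τ`-differential `τf` of `f ∈ K[U]`. -/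
def tauDiff (U : V.Opens) (f : Γ(V, U)) : Psi K U := fun p => p.1.tauGerm (p.1.germ p.2 f)

theorem res_tauDiff {U W : V.Opens} (h : W ≤ U) (f : Γ(V, U)) :
    Psi.res h (tauDiff K U f) = tauDiff K W (resFun h f) :=
  funext fun p => congrArg p.1.tauGerm
    (TopCat.Presheaf.germ_res_apply V.presheaf (homOfLE h) p.1.pt p.2 f).symm

variable (K) in
/-- The `K[U]`-submodule of `Ψ[U]` generated by the `τ`-differentials `τf`, `f ∈ K[U]`. -/
def tauSpan (U : V.Opens) : Submodule Γ(V, U) (Psi K U) :=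
  Submodule.span Γ(V, U) (Set.range (tauDiff K U))

theorem res_mem_tauSpan {U W : V.Opens} (h : W ≤ U) {ψ : Psi K U} (hψ : ψ ∈ tauSpan K U) :
    Psi.res h ψ ∈ tauSpan K W := by
  induction hψ using Submodule.span_induction with
  | mem ψ hψ =>
    obtain ⟨f, rfl⟩ := hψ
    rw [res_tauDiff]
    exact Submodule.subset_span ⟨_, rfl⟩
  | zero => rw [map_zero]; exact zero_mem _
  | add ψ φ _ _ h₁ h₂ => rw [map_add]; exact add_mem h₁ h₂
  | smul g ψ _ h₁ => rw [LinearMap.map_smulₛₗ]; exact Submodule.smul_mem _ _ h₁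

variable (K) in
/-- `Ω^τ[U]`: the regular `τ`-forms on `U`, that is, the `ψ ∈ Ψ[U]` such that every point of `U`
has a neighbourhood `W ⊆ U` on which `ψ` lies in the `K[W]`-submodule of `Ψ[W]` generated by the
`τf`, `f ∈ K[W]`. -/
def TauForm (U : V.Opens) : Submodule Γ(V, U) (Psi K U) where
  carrier := {ψ | ∀ x ∈ U, ∃ (W : V.Opens) (h : W ≤ U), x ∈ W ∧ Psi.res h ψ ∈ tauSpan K W}
  add_mem' := by
    intro ψ φ hψ hφ x hx
    obtain ⟨W₁, h₁, hx₁, H₁⟩ := hψ x hx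
    obtain ⟨W₂, h₂, hx₂, H₂⟩ := hφ x hx
    refine ⟨W₁ ⊓ W₂, inf_le_left.trans h₁, ⟨hx₁, hx₂⟩, ?_⟩
    rw [map_add]
    exact add_mem (res_mem_tauSpan inf_le_left H₁) (res_mem_tauSpan inf_le_right H₂)
  zero_mem' := fun x hx => ⟨U, le_rfl, hx, by rw [map_zero]; exact zero_mem _⟩
  smul_mem' := by
    intro g ψ hψ x hx
    obtain ⟨W, h, hxW, H⟩ := hψ x hx
    refine ⟨W, h, hxW, ?_⟩
    rw [LinearMap.map_smulₛₗ]
    exact Submodule.smul_mem _ _ H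

/-- Restriction of regular `τ`-forms on `U` to an open set `W ⊆ U`. -/
def TauForm.res {U W : V.Opens} (h : W ≤ U) : TauForm K U →ₛₗ[resFun h] TauForm K W where
  toFun ω := ⟨Psi.res h ω.1, fun x hx => by
    obtain ⟨W', h', hx', H⟩ := ω.2 x (h hx)
    exact ⟨W' ⊓ W, inf_le_right, ⟨hx', hx⟩, res_mem_tauSpan inf_le_left H⟩⟩
  map_add' ω η := Subtype.ext (map_add (Psi.res h) ω.1 η.1)
  map_smul' g ω := Subtype.ext (LinearMap.map_smulₛₗ (Psi.res h) g ω.1)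

theorem TauForm.res_res {U W W' : V.Opens} (h : W ≤ U) (h' : W' ≤ W) (ω : TauForm K U) :
    TauForm.res h' (TauForm.res h ω) = TauForm.res (h'.trans h) ω := rfl

theorem TauForm.res_self {U : V.Opens} (ω : TauForm K U) : TauForm.res le_rfl ω = ω := rfl

end Regular

/-! ### Rational `τ`-forms -/

section Rational

variable [Differential K] [IrreducibleSpace V]

theorem nonempty_inf {U W : V.Opens} (hU : (U : Set V).Nonempty) (hW : (W : Set V).Nonempty) :
    ((U ⊓ W : V.Opens) : Set V).Nonempty :=
  nonempty_preirreducible_inter U.isOpen W.isOpen hU hW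

variable (K V) in
/-- A regular `τ`-form on some nonempty open subset of `V`. -/
structure LocalTauForm where
  dom : V.Opens
  nonempty_dom : (dom : Set V).Nonempty
  form : TauForm K dom

variable (K V) in
/-- Two regular `τ`-forms on nonempty open sets are equivalent if they agree on some nonempty open
set contained in both domains. -/
instance localTauFormSetoid : Setoid (LocalTauForm K V) where
  r ω η := ∃ (W : V.Opens) (h₁ : W ≤ ω.dom) (h₂ : W ≤ η.dom), (W : Set V).Nonempty ∧
    TauForm.res h₁ ω.form = TauForm.res h₂ η.form
  iseqv :=
    { refl := fun ω => ⟨ω.dom, le_rfl, le_rfl, ω.nonempty_dom, rfl⟩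
      symm := fun ⟨W, h₁, h₂, hW, e⟩ => ⟨W, h₂, h₁, hW, e.symm⟩
      trans := fun ⟨W, h₁, h₂, hW, e⟩ ⟨W', h₁', h₂', hW', e'⟩ =>
        ⟨W ⊓ W', inf_le_left.trans h₁, inf_le_right.trans h₂', nonempty_inf hW hW', by
          have a := congrArg (TauForm.res (inf_le_left : W ⊓ W' ≤ W)) e
          have b := congrArg (TauForm.res (inf_le_right : W ⊓ W' ≤ W')) e'
          exact a.trans b⟩ }

variable (K V) in
/-- `Ω^τ(V)`: the rational `τ`-forms on `V`. -/
def RatTauForm : Type u := Quotient (localTauFormSetoid K V)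

namespace RatTauForm

/-- The rational `τ`-form given by a regular `τ`-form on a nonempty open set. -/
def mk {U : V.Opens} (hU : (U : Set V).Nonempty) (ω : TauForm K U) : RatTauForm K V :=
  Quotient.mk _ ⟨U, hU, ω⟩

theorem exists_rep (a : RatTauForm K V) :
    ∃ (U : V.Opens) (hU : (U : Set V).Nonempty) (ω : TauForm K U), a = mk hU ω := by
  induction a using Quotient.inductionOn with
  | h a => exact ⟨a.dom, a.nonempty_dom, a.form, rfl⟩

theorem mk_eq_mk {U W : V.Opens} {hU : (U : Set V).Nonempty} {hW : (W : Set V).Nonempty}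
    {ω : TauForm K U} {η : TauForm K W} (O : V.Opens) (h₁ : O ≤ U) (h₂ : O ≤ W)
    (hO : (O : Set V).Nonempty) (e : TauForm.res h₁ ω = TauForm.res h₂ η) :
    mk hU ω = mk hW η :=
  Quotient.sound ⟨O, h₁, h₂, hO, e⟩

theorem mk_res {U W : V.Opens} (hU : (U : Set V).Nonempty) (hW : (W : Set V).Nonempty)
    (h : W ≤ U) (ω : TauForm K U) : mk hW (TauForm.res h ω) = mk hU ω :=
  mk_eq_mk W le_rfl h hW rfl

/-- A rational `τ`-form can be represented on an open set contained in a given one. -/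
theorem exists_rep_on (a : RatTauForm K V) {O : V.Opens} (hO : (O : Set V).Nonempty) :
    ∃ (U : V.Opens) (hU : (U : Set V).Nonempty) (_ : U ≤ O) (ω : TauForm K U), a = mk hU ω := by
  obtain ⟨U, hU, ω, rfl⟩ := exists_rep a
  exact ⟨U ⊓ O, nonempty_inf hU hO, inf_le_right, TauForm.res inf_le_left ω,
    (mk_res _ _ _ _).symm⟩

instance : Zero (RatTauForm K V) :=
  ⟨mk (U := ⊤) ⟨genericPoint V, trivial⟩ 0⟩

instance : Neg (RatTauForm K V) :=
  ⟨Quotient.map (fun a => ⟨a.dom, a.nonempty_dom, -a.form⟩)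
    (fun _ _ ⟨W, h₁, h₂, hW, e⟩ => ⟨W, h₁, h₂, hW, congrArg Neg.neg e⟩)⟩

/-- Rational `τ`-forms are added on the intersection of their domains. -/
instance : Add (RatTauForm K V) :=
  ⟨Quotient.map₂ (fun a b => ⟨a.dom ⊓ b.dom, nonempty_inf a.nonempty_dom b.nonempty_dom,
      TauForm.res inf_le_left a.form + TauForm.res inf_le_right b.form⟩)
    (fun _ _ ⟨W, h₁, h₂, hW, e⟩ _ _ ⟨W', h₁', h₂', hW', e'⟩ =>
      ⟨W ⊓ W', inf_le_inf h₁ h₁', inf_le_inf h₂ h₂', nonempty_inf hW hW',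
        congrArg₂ (· + ·) (congrArg (TauForm.res (inf_le_left : W ⊓ W' ≤ W)) e)
          (congrArg (TauForm.res (inf_le_right : W ⊓ W' ≤ W')) e')⟩)⟩

theorem zero_eq {U : V.Opens} (hU : (U : Set V).Nonempty) :
    (0 : RatTauForm K V) = mk hU 0 :=
  mk_eq_mk U le_top le_rfl hU rfl

theorem neg_mk {U : V.Opens} (hU : (U : Set V).Nonempty) (ω : TauForm K U) :
    -mk hU ω = mk hU (-ω) := rfl

theorem mk_add_mk {U : V.Opens} (hU : (U : Set V).Nonempty) (ω η : TauForm K U) :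
    mk hU ω + mk hU η = mk hU (ω + η) :=
  mk_eq_mk U (le_inf le_rfl le_rfl) le_rfl hU rfl

theorem exists_rep₂ (a b : RatTauForm K V) :
    ∃ (U : V.Opens) (hU : (U : Set V).Nonempty) (ω η : TauForm K U),
      a = mk hU ω ∧ b = mk hU η := by
  obtain ⟨U, hU, ω, rfl⟩ := exists_rep a
  obtain ⟨W, hW, h, η, rfl⟩ := exists_rep_on b hU
  exact ⟨W, hW, TauForm.res h ω, η, (mk_res _ _ _ _).symm, rfl⟩

theorem exists_rep₃ (a b c : RatTauForm K V) :
    ∃ (U : V.Opens) (hU : (U : Set V).Nonempty) (ω η θ : TauForm K U),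
      a = mk hU ω ∧ b = mk hU η ∧ c = mk hU θ := by
  obtain ⟨U, hU, ω, η, rfl, rfl⟩ := exists_rep₂ a b
  obtain ⟨W, hW, h, θ, rfl⟩ := exists_rep_on c hU
  exact ⟨W, hW, TauForm.res h ω, TauForm.res h η, θ, (mk_res _ _ _ _).symm,
    (mk_res _ _ _ _).symm, rfl⟩

instance : AddCommGroup (RatTauForm K V) where
  add_assoc a b c := by
    obtain ⟨U, hU, ω, η, θ, rfl, rfl, rfl⟩ := exists_rep₃ a b c
    simp only [mk_add_mk, add_assoc]
  zero_add a := by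
    obtain ⟨U, hU, ω, rfl⟩ := exists_rep a
    rw [zero_eq hU, mk_add_mk, zero_add]
  add_zero a := by
    obtain ⟨U, hU, ω, rfl⟩ := exists_rep a
    rw [zero_eq hU, mk_add_mk, add_zero]
  add_comm a b := by
    obtain ⟨U, hU, ω, η, rfl, rfl⟩ := exists_rep₂ a b
    simp only [mk_add_mk, add_comm]
  neg_add_cancel a := by
    obtain ⟨U, hU, ω, rfl⟩ := exists_rep a
    rw [neg_mk, mk_add_mk, neg_add_cancel, ← zero_eq]
  nsmul := nsmulRec
  zsmul := zsmulRec

theorem genericPoint_mem {U : V.Opens} (hU : (U : Set V).Nonempty) : genericPoint V ∈ U :=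
  ((genericPoint_spec V).mem_open_set_iff U.isOpen).mpr (by simpa using hU)

/-- The rational function given by a regular function on a nonempty open set. -/
def ratFun {U : V.Opens} (hU : (U : Set V).Nonempty) : Γ(V, U) →+* V.functionField :=
  (V.presheaf.germ U (genericPoint V) (genericPoint_mem hU)).hom

theorem ratFun_res {U W : V.Opens} (hU : (U : Set V).Nonempty) (hW : (W : Set V).Nonempty)
    (h : W ≤ U) (g : Γ(V, U)) : ratFun hW (resFun h g) = ratFun hU g :=
  TopCat.Presheaf.germ_res_apply V.presheaf (homOfLE h) _ _ g

theorem exists_ratFun (r : V.functionField) :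
    ∃ (U : V.Opens) (hU : (U : Set V).Nonempty) (g : Γ(V, U)), r = ratFun hU g := by
  obtain ⟨U, hU, g, rfl⟩ := V.presheaf.exists_germ_eq r
  exact ⟨U, ⟨_, hU⟩, g, rfl⟩

theorem exists_ratFun_on (r : V.functionField) {O : V.Opens} (hO : (O : Set V).Nonempty) :
    ∃ (U : V.Opens) (hU : (U : Set V).Nonempty) (_ : U ≤ O) (g : Γ(V, U)), r = ratFun hU g := by
  obtain ⟨U, hU, g, rfl⟩ := exists_ratFun r
  exact ⟨U ⊓ O, nonempty_inf hU hO, inf_le_right, resFun inf_le_left g, (ratFun_res _ _ _ _).symm⟩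

theorem mk_smul_congr {U U' : V.Opens} {hU : (U : Set V).Nonempty} {hU' : (U' : Set V).Nonempty}
    {g : Γ(V, U)} {g' : Γ(V, U')} {ω : TauForm K U} {ω' : TauForm K U'}
    (hg : ratFun hU g = ratFun hU' g') (hω : mk hU ω = mk hU' ω') :
    mk hU (g • ω) = mk hU' (g' • ω') := by
  obtain ⟨O, hO, i, i', e⟩ := V.presheaf.germ_eq _ (genericPoint_mem hU) (genericPoint_mem hU')
    g g' hg
  obtain ⟨W, h, h', hW, e'⟩ := Quotient.exact hω
  refine mk_eq_mk (O ⊓ W) (inf_le_right.trans h) (inf_le_right.trans h')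
    (nonempty_inf ⟨_, hO⟩ hW) ?_
  have e₁ : resFun (inf_le_right.trans h : O ⊓ W ≤ U) g =
      resFun (inf_le_right.trans h' : O ⊓ W ≤ U') g' := by
    have a := congrArg (resFun (inf_le_left : O ⊓ W ≤ O)) e
    simp only [resFun, ← CategoryTheory.comp_apply, ← Functor.map_comp] at a
    exact a
  have e₂ : TauForm.res (inf_le_right.trans h : O ⊓ W ≤ U) ω =
      TauForm.res (inf_le_right.trans h' : O ⊓ W ≤ U') ω' :=
    congrArg (TauForm.res (inf_le_right : O ⊓ W ≤ W)) e'
  rw [LinearMap.map_smulₛₗ, LinearMap.map_smulₛₗ, e₁, e₂]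

theorem exists_rep_smul (r : V.functionField) (a : RatTauForm K V) :
    ∃ (U : V.Opens) (hU : (U : Set V).Nonempty) (g : Γ(V, U)) (ω : TauForm K U),
      r = ratFun hU g ∧ a = mk hU ω := by
  obtain ⟨U, hU, ω, rfl⟩ := exists_rep a
  obtain ⟨W, hW, h, g, rfl⟩ := exists_ratFun_on r hU
  exact ⟨W, hW, g, TauForm.res h ω, rfl, (mk_res _ _ _ _).symm⟩

/-- A rational function and a rational `τ`-form are multiplied on any nonempty open set on which
both are regular; `ratFun_smul_mk` says that the result does not depend on the choices. -/
instance : SMul V.functionField (RatTauForm K V) :=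
  ⟨fun r a => mk (exists_rep_smul r a).choose_spec.choose
    ((exists_rep_smul r a).choose_spec.choose_spec.choose •
      (exists_rep_smul r a).choose_spec.choose_spec.choose_spec.choose)⟩

theorem ratFun_smul_mk {U : V.Opens} (hU : (U : Set V).Nonempty) (g : Γ(V, U))
    (ω : TauForm K U) : ratFun hU g • mk hU ω = mk hU (g • ω) := by
  have h := (exists_rep_smul (ratFun hU g) (mk hU ω)).choose_spec.choose_spec.choose_spec.choose_spec
  exact mk_smul_congr h.1.symm h.2.symm

/-- `Ω^τ(V)` is a vector space over the field `K(V)` of rational functions. -/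
instance : Module V.functionField (RatTauForm K V) where
  one_smul a := by
    obtain ⟨U, hU, ω, rfl⟩ := exists_rep a
    rw [← map_one (ratFun hU), ratFun_smul_mk, one_smul]
  mul_smul r s a := by
    obtain ⟨U, hU, g, ω, rfl, rfl⟩ := exists_rep_smul r a
    obtain ⟨W, hW, h, k, rfl⟩ := exists_ratFun_on s hU
    rw [← ratFun_res hU hW h, ← mk_res hU hW h, ← map_mul, ratFun_smul_mk, ratFun_smul_mk,
      ratFun_smul_mk, mul_smul]
  smul_zero r := by
    obtain ⟨U, hU, g, rfl⟩ := exists_ratFun r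
    rw [zero_eq hU, ratFun_smul_mk, smul_zero]
  smul_add r a b := by
    obtain ⟨U, hU, ω, η, rfl, rfl⟩ := exists_rep₂ a b
    obtain ⟨W, hW, h, g, rfl⟩ := exists_ratFun_on r hU
    rw [← mk_res hU hW h ω, ← mk_res hU hW h η, mk_add_mk, ratFun_smul_mk, ratFun_smul_mk,
      ratFun_smul_mk, mk_add_mk, smul_add]
  add_smul r s a := by
    obtain ⟨U, hU, g, ω, rfl, rfl⟩ := exists_rep_smul r a
    obtain ⟨W, hW, h, k, rfl⟩ := exists_ratFun_on s hU
    rw [← ratFun_res hU hW h, ← mk_res hU hW h, ← map_add, ratFun_smul_mk, ratFun_smul_mk,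
      ratFun_smul_mk, mk_add_mk, add_smul]
  zero_smul a := by
    obtain ⟨U, hU, ω, rfl⟩ := exists_rep a
    rw [← map_zero (ratFun hU), ratFun_smul_mk, zero_smul, ← zero_eq]

end RatTauForm

end Rational

end TauForms

end

/-! ### Consequences of differential closedness -/

section DifferentialFields

open scoped Differential

namespace TauForms

/-! On a small affine open U the regular τ-forms are Ω_{K[U]/K} × K[U]. By smoothness δ extends to a
derivation d of K[U], that is, the prolongation has a section over U. Subtracting it from τ makes f
↦ τf - d(f) a K-linear derivation, which factors through Ω_{K[U]/K}; adding multiples of the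
constant function 1 gives a linear map from Ω_{K[U]/K} × K[U] to Ψ[U]. Its image is `tauSpan`,
because 1 = τt for any t with t′ = 1, and a differentially closed field has such a t
(`range_presentation`). It is injective, because every K-derivation e of K[U] gives another section
d + e, along which the image of (ω, g) takes the values of e(ω) + g, and K-points separate functions
as K is algebraically closed (`presentation_injective`). Clearing denominators shows that on an
affine open set locally generated forms are generated globally (`tauForm_eq_tauSpan`). The rank of
Ω_{K[U]/K} can be computed at the generic point, where Noether normalization and separability
identify it with the dimension (`ringKrullDim_eq_finrank_kaehlerDifferential`). Finally, a basis of
Ω^τ[U] over K[U] stays a basis of Ω^τ(V) over K(V) (`RatTauForm.finrank_eq`). -/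

/-- Allows g = 1 in Blum's axiom, so that every nonconstant differential polynomial has a zero. -/
theorem DiffPoly.order_one_lt {K : Type*} [Field K] {f : DiffPoly K}
    (hf : ∀ c, f ≠ MvPolynomial.C c) : DiffPoly.order (1 : DiffPoly K) < f.order := by
  have h1 : DiffPoly.order (1 : DiffPoly K) = ⊥ := by
    rw [DiffPoly.order, MvPolynomial.vars_one, Finset.max_empty]
  rw [h1, bot_lt_iff_ne_bot, DiffPoly.order, Ne, Finset.max_eq_bot,
    MvPolynomial.vars_eq_empty_iff_eq_C]
  exact hf _

theorem IsDifferentiallyClosed.isAlgClosed (K : Type*) [Field K] [Differential K]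
    [IsDifferentiallyClosed K] : IsAlgClosed K := by
  refine IsAlgClosed.of_exists_root K fun p _ hp => ?_
  obtain ⟨a, ha, -⟩ := IsDifferentiallyClosed.exists_root
    (Polynomial.aeval (MvPolynomial.X 0) p : DiffPoly K) 1 one_ne_zero
    (DiffPoly.order_one_lt fun c hc => by
      -- Substituting `Polynomial.X` for every variable recovers p, which would then be a constant.
      have h := congrArg (MvPolynomial.aeval fun _ => (Polynomial.X : Polynomial K)) hc
      rw [← Polynomial.aeval_algHom_apply, MvPolynomial.aeval_X, Polynomial.aeval_X_left_apply,
        MvPolynomial.aeval_C] at h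
      exact Polynomial.not_isUnit_of_degree_pos p (Polynomial.degree_pos_of_irreducible hp)
        (h ▸ (IsUnit.mk0 c fun h0 => hp.ne_zero (by rw [h, h0, map_zero])).map _))
  refine ⟨a, ?_⟩
  rw [DiffPoly.evalAt, ← MvPolynomial.aeval_eq_eval, ← Polynomial.aeval_algHom_apply,
    MvPolynomial.aeval_X, Polynomial.coe_aeval_eq_eval] at ha
  exact ha

theorem IsDifferentiallyClosed.exists_deriv_eq_one (K : Type*) [Field K] [Differential K]
    [IsDifferentiallyClosed K] : ∃ t : K, t′ = 1 := by
  obtain ⟨a, ha, -⟩ := IsDifferentiallyClosed.exists_root (K := K)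
    (MvPolynomial.X 1 - MvPolynomial.C 1) 1 one_ne_zero (DiffPoly.order_one_lt fun c hc => by
      have h₀ := congrArg (MvPolynomial.eval fun _ => 0) hc
      have h₁ := congrArg (MvPolynomial.eval fun _ => 1) hc
      simp only [map_sub, MvPolynomial.eval_X, MvPolynomial.eval_C] at h₀ h₁
      simp [← h₀] at h₁)
  exact ⟨a, by simpa [DiffPoly.evalAt, sub_eq_zero] using ha⟩

end TauForms

end DifferentialFields

/-! ### Extending a derivation of the base -/

section RelativeDerivations

open KaehlerDifferential TensorProduct

/-- A derivation of the base extends to a formally smooth algebra. -/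
theorem Derivation.exists_extension_of_formallySmooth {R S : Type u} [CommRing R] [CommRing S]
    [Algebra R S] [Algebra.FormallySmooth R S] (d : Derivation ℤ R R) :
    ∃ D : Derivation ℤ S S, ∀ r, D (algebraMap R S r) = algebraMap R S (d r) := by
  -- The kernel of S ⊗ Ω_R → Ω_S is the image of `H1Cotangent`, which vanishes by formal smoothness.
  have hinj : Function.Injective (mapBaseChange ℤ R S) := by
    rw [injective_iff_map_eq_zero]
    intro x hx
    obtain ⟨x, rfl⟩ := (Algebra.H1Cotangent.exact_δ_mapBaseChange ℤ R S x).mp hx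
    rw [Subsingleton.elim x 0, map_zero]
  obtain ⟨s, hs⟩ := Module.projective_lifting_property (map ℤ R S S) LinearMap.id
    (map_surjective ℤ R S)
  -- As Ω_{S/R} is projective, the cotangent sequence splits; the retraction l carries d over to S.
  obtain ⟨-, l, hl⟩ :=
    ((exact_mapBaseChange_map ℤ R S).split_tfae'.out 0 1 rfl rfl).mp ⟨hinj, s, hs⟩
  let e : Derivation ℤ R S := (Algebra.linearMap R S).compDer d
  refine ⟨((e.liftKaehlerDifferential.liftBaseChange S) ∘ₗ l).compDer (KaehlerDifferential.D ℤ S),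
    fun r => ?_⟩
  have h := LinearMap.congr_fun hl (1 ⊗ₜ KaehlerDifferential.D ℤ R r)
  simp only [LinearMap.comp_apply, mapBaseChange_tmul, map_D, one_smul, LinearMap.id_apply] at h
  change e.liftKaehlerDifferential.liftBaseChange S (l (KaehlerDifferential.D ℤ S _)) = _
  rw [h, LinearMap.liftBaseChange_tmul, one_smul, Derivation.liftKaehlerDifferential_comp_D]
  rfl

end RelativeDerivations

/-! ### Krull dimension and Kähler differentials -/

section Dimension

/-- The Krull dimension is invariant under injective integral extensions. -/
theorem ringKrullDim_eq_of_isIntegral {R S : Type*} [CommRing R] [CommRing S] [Algebra R S]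
    [Algebra.IsIntegral R S] (h : Function.Injective (algebraMap R S)) :
    ringKrullDim R = ringKrullDim S := by
  apply le_antisymm
  -- Chains of primes lift by lying over and going up.
  · refine iSup_le fun l => ?_
    obtain ⟨P, hP, hPl⟩ := Ideal.exists_ideal_over_prime_of_isIntegral l.head.asIdeal (⊥ : Ideal S)
      (by rw [← RingHom.ker_eq_comap_bot, (RingHom.injective_iff_ker_eq_bot _).mp h]; exact bot_le)
    have : P.LiesOver l.head.asIdeal := ⟨hPl.2.symm⟩
    have := hPl.1
    obtain ⟨l', hl', -⟩ := Ideal.exists_ltSeries_of_hasGoingUp l P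
    rw [← hl']
    exact Order.LTSeries.length_le_krullDim l'
  -- By incomparability, contraction keeps strict inclusions strict.
  · exact Order.krullDim_le_of_strictMono (PrimeSpectrum.comap (algebraMap R S))
      fun I J hIJ => Ideal.IsIntegral.comap_lt_comap hIJ

-- Localization is formally étale, so Ω of the fraction field is the base change of Ω of the ring.
open TensorProduct in
theorem finrank_kaehlerDifferential_of_isFractionRing (K A L : Type u) [CommRing K] [CommRing A]
    [IsDomain A] [Field L] [Algebra K A] [Algebra K L] [Algebra A L] [IsScalarTower K A L]
    [IsFractionRing A L] [Module.Free A Ω[A⁄K]] :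
    Module.finrank L Ω[L⁄K] = Module.finrank A Ω[A⁄K] := by
  have := Algebra.FormallyEtale.of_isLocalization (Rₘ := L) (nonZeroDivisors A)
  rw [← (KaehlerDifferential.tensorKaehlerEquivOfFormallyEtale K A L).finrank_eq,
    Module.finrank_baseChange]

/-- In characteristic zero, the dimension of a domain of finite type over a field is the number of
independent differentials of its fraction field. -/
theorem ringKrullDim_eq_finrank_kaehlerDifferential (K A L : Type u) [Field K] [CharZero K]
    [CommRing A] [IsDomain A] [Field L] [Algebra K A] [Algebra K L] [Algebra A L]
    [IsScalarTower K A L] [IsFractionRing A L] [Algebra.FiniteType K A] :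
    ringKrullDim A = Module.finrank L Ω[L⁄K] := by
  -- Noether normalization: both sides turn out to be the number s of variables.
  obtain ⟨s, g, hg, hint⟩ := exists_integral_inj_algHom_of_fg K A
  let P := MvPolynomial (Fin s) K
  algebraize [g.toRingHom]
  let _ : Algebra P L := ((algebraMap A L).comp g.toRingHom).toAlgebra
  have : IsScalarTower P A L := .of_algebraMap_eq fun _ => rfl
  have : IsScalarTower K P L := .of_algebraMap_eq fun c => by
    rw [IsScalarTower.algebraMap_apply K A L, IsScalarTower.algebraMap_apply P A L]
    congr 1
    exact (g.commutes c).symm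
  have : Algebra.IsIntegral P A := ⟨hint⟩
  have hinj : Function.Injective (algebraMap P A) := hg
  have : FaithfulSMul P A := (faithfulSMul_iff_algebraMap_injective P A).mpr hg
  have : FaithfulSMul P L := (faithfulSMul_iff_algebraMap_injective P L).mpr
    ((IsFractionRing.injective A L).comp hg)
  let F := FractionRing P
  have : Algebra.IsAlgebraic P L := (IsFractionRing.isAlgebraic_iff' P A L).mp inferInstance
  let _ : Algebra F L := FractionRing.liftAlgebra P L
  have : IsScalarTower P F L := FractionRing.isScalarTower_liftAlgebra P L
  have : Algebra.IsAlgebraic F L :=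
    (IsFractionRing.comap_isAlgebraic_iff (A := P)).mp inferInstance
  -- Characteristic zero makes the algebraic extension L/F separable, so P → F → L is formally étale
  -- and Ω_{L/K} = L ⊗ Ω_{P/K}.
  have : CharZero F := charZero_of_injective_algebraMap (algebraMap K F).injective
  have : Algebra.FormallyEtale F L := .of_isSeparable F L
  have : Algebra.FormallyEtale P F := .of_isLocalization (nonZeroDivisors P)
  have : Algebra.FormallyEtale P L := .comp P F L
  rw [← ringKrullDim_eq_of_isIntegral hinj, MvPolynomial.ringKrullDim_of_isNoetherianRing,
    ringKrullDim_eq_zero_of_field, zero_add,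
    ← (KaehlerDifferential.tensorKaehlerEquivOfFormallyEtale K P L).finrank_eq,
    Module.finrank_baseChange,
    Module.finrank_eq_nat_card_basis (KaehlerDifferential.mvPolynomialBasis K (Fin s))]

end Dimension

/-! ### Étale extension of derivations and the Nullstellensatz -/

section Algebra

/-- A derivation on a ring extends to every formally étale algebra. -/
theorem Derivation.exists_extension_of_formallyEtale {A B : Type u} {M : Type*} [CommRing A]
    [CommRing B] [Algebra A B] [Algebra.FormallyEtale A B] [AddCommGroup M] [Module A M]
    [Module B M] [IsScalarTower A B M] (d : Derivation ℤ A M) :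
    ∃ D : Derivation ℤ B M, ∀ a, D (algebraMap A B a) = d a := by
  refine ⟨((d.liftKaehlerDifferential.liftBaseChange B) ∘ₗ
    (KaehlerDifferential.tensorKaehlerEquivOfFormallyEtale ℤ A B).symm.toLinearMap).compDer
    (KaehlerDifferential.D ℤ B), fun a => ?_⟩
  change d.liftKaehlerDifferential.liftBaseChange B
    ((KaehlerDifferential.tensorKaehlerEquivOfFormallyEtale ℤ A B).symm
      (KaehlerDifferential.D ℤ B _)) = _
  rw [KaehlerDifferential.tensorKaehlerEquivOfFormallyEtale_symm_D_algebraMap,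
    LinearMap.liftBaseChange_tmul, one_smul, Derivation.liftKaehlerDifferential_comp_D]

/-- The points of a reduced algebra of finite type over an algebraically closed field separate its
elements. -/
theorem eq_zero_of_forall_algHom_eq_zero {K A : Type*} [Field K] [IsAlgClosed K] [CommRing A]
    [IsReduced A] [Algebra K A] [Algebra.FiniteType K A] (a : A) (h : ∀ φ : A →ₐ[K] K, φ a = 0) :
    a = 0 := by
  have : IsJacobsonRing A := isJacobsonRing_of_finiteType (A := K)
  -- It suffices that a lies in every maximal ideal, and every residue field is K.
  have hJ : (⊥ : Ideal A).jacobson = ⊥ := IsJacobsonRing.out ‹_› (nilradical_eq_zero A).le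
  rw [← Ideal.mem_bot, ← hJ, Ideal.jacobson, Ideal.mem_sInf]
  rintro M ⟨-, hM⟩
  let _ := Ideal.Quotient.field M
  have : Module.Finite K (A ⧸ M) := finite_of_finite_type_of_isJacobsonRing K (A ⧸ M)
  let e := AlgEquiv.ofBijective (Algebra.ofId K (A ⧸ M))
    IsAlgClosed.algebraMap_bijective_of_isIntegral
  have := h (e.symm.toAlgHom.comp (Ideal.Quotient.mkₐ K M))
  simpa [Ideal.Quotient.eq_zero_iff_mem] using this

end Algebra

/-! ### K-points of V and derivations at them -/

noncomputable section

namespace TauForms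

open CategoryTheory Opposite
open scoped Differential

variable (K : Type u) [Field K] {V : Scheme.{u}} [V.Over (Spec (.of K))]

/-- The functions on an open set form an algebra over the base field. -/
@[reducible]
def constAlgebra (U : V.Opens) : Algebra K Γ(V, U) :=
  ((Scheme.ΓSpecIso (.of K)).inv ≫ (V ↘ Spec (.of K)).appLE ⊤ U le_top).hom.toAlgebra

attribute [local instance] constAlgebra

variable {K}

theorem algebraMap_eq_appLE (U : V.Opens) :
    CommRingCat.ofHom (algebraMap K Γ(V, U)) =
      (Scheme.ΓSpecIso (.of K)).inv ≫ (V ↘ Spec (.of K)).appLE ⊤ U le_top := rfl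

theorem germ_algebraMap {U : V.Opens} {x : V} (hx : x ∈ U) (c : K) :
    V.presheaf.germ U x hx (algebraMap K Γ(V, U) c) = constGerm K x c := by
  have h : CommRingCat.ofHom (algebraMap K Γ(V, U)) ≫ V.presheaf.germ U x hx =
      CommRingCat.ofHom (constGerm K x) := by
    rw [algebraMap_eq_appLE]
    change _ = (Scheme.ΓSpecIso (.of K)).inv ≫ (V ↘ Spec (.of K)).appTop ≫ _
    rw [Category.assoc]
    congr 1
    exact (Category.assoc _ _ _).trans (congrArg _ (V.presheaf.germ_res _ _ _))
  exact congr($h c)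

namespace KPoint

instance (p : KPoint K V) : IsLocalHom p.evalGerm :=
  inferInstanceAs (IsLocalHom (Scheme.stalkClosedPointTo p.hom).hom)

/-- This is the condition that p is a section of the structure morphism, read on functions. -/
theorem evalGerm_constGerm (p : KPoint K V) (c : K) : p.evalGerm (constGerm K p.pt c) = c := by
  have h : CommRingCat.ofHom (constGerm K p.pt) ≫ Scheme.stalkClosedPointTo p.hom = 𝟙 _ := by
    change ((Scheme.ΓSpecIso (.of K)).inv ≫ (V ↘ Spec (.of K)).appTop ≫
      V.presheaf.germ ⊤ p.pt _) ≫ _ = _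
    rw [Category.assoc, Category.assoc, Scheme.germ_stalkClosedPointTo]
    have h := congr(Scheme.Hom.appTop $(p.isSection))
    rw [Scheme.Hom.comp_appTop] at h
    change _ ≫ _ ≫ p.hom.appTop ≫ (Spec (.of K)).presheaf.map (𝟙 _) ≫ _ = _
    rw [reassoc_of% h, CategoryTheory.Functor.map_id, Category.id_comp, Scheme.Hom.id_appTop,
      Category.id_comp, Iso.inv_hom_id]
  exact congr($h c)

theorem eval_algebraMap (p : KPoint K V) {U : V.Opens} (hp : p.pt ∈ U) (c : K) :
    p.eval hp (algebraMap K Γ(V, U) c) = c := by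
  rw [eval, RingHom.comp_apply, germ, germ_algebraMap, evalGerm_constGerm]

theorem mem_basicOpen_iff (p : KPoint K V) {U : V.Opens} (hp : p.pt ∈ U) (h : Γ(V, U)) :
    p.pt ∈ V.basicOpen h ↔ p.eval hp h ≠ 0 := by
  rw [V.mem_basicOpen _ _ hp, ← isUnit_iff_ne_zero]
  exact (isUnit_map_iff p.evalGerm _).symm

/-- An algebra homomorphism from the functions on an affine open set to the base field comes from
a point. -/
theorem exists_eval_eq {U : V.Opens} (hU : IsAffineOpen U) (φ : Γ(V, U) →ₐ[K] K) :
    ∃ (p : KPoint K V) (hp : p.pt ∈ U), p.eval hp = φ := by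
  let f : Spec (.of K) ⟶ V := Spec.map (CommRingCat.ofHom φ.toRingHom) ≫ hU.fromSpec
  have hp : f (IsLocalRing.closedPoint K) ∈ U := by
    rw [← SetLike.mem_coe, ← hU.range_fromSpec]
    exact ⟨_, rfl⟩
  have hf : f ≫ (V ↘ Spec (.of K)) = 𝟙 _ := by
    rw [Category.assoc, ← (isAffineOpen_top _).SpecMap_appLE_fromSpec _ hU le_top,
      IsAffineOpen.fromSpec_top, Scheme.isoSpec_Spec_inv, ← Spec.map_comp, ← Spec.map_comp,
      ← Spec.map_id]
    congr 1
    ext c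
    exact φ.commutes c
  refine ⟨⟨f, hf⟩, hp, ?_⟩
  -- Evaluation at the new point and φ induce the same morphism to V; `fromSpec` is a monomorphism,
  -- so they agree.
  have h := Scheme.Spec_stalkClosedPointTo_fromSpecStalk f
  rw [← hU.fromSpecStalk_eq_fromSpecStalk hp, IsAffineOpen.fromSpecStalk, ← Spec.map_comp_assoc,
    cancel_mono] at h
  exact congrArg CommRingCat.Hom.hom (Spec.map_injective h)

theorem eq_zero_of_forall_eval_eq_zero [IsAlgClosed K] {U : V.Opens} (hU : IsAffineOpen U)
    [IsReduced Γ(V, U)] [Algebra.FiniteType K Γ(V, U)] (g : Γ(V, U))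
    (h : ∀ (p : KPoint K V) (hp : p.pt ∈ U), p.eval hp g = 0) : g = 0 :=
  eq_zero_of_forall_algHom_eq_zero g fun φ => by
    obtain ⟨p, hp, hφ⟩ := exists_eval_eq (K := K) hU φ
    exact congr($hφ g).symm.trans (h p hp)

variable [Differential K]

/-- A derivation on an affine open set which extends the derivation of the base field gives an
element of the fibre of the prolongation. -/
theorem exists_der_germ_eq (p : KPoint K V) {U : V.Opens} (hU : IsAffineOpen U) (hp : p.pt ∈ U)
    (d : Derivation ℤ Γ(V, U) Γ(V, U))
    (hd : ∀ c : K, d (algebraMap K Γ(V, U) c) = algebraMap K Γ(V, U) (c′)) :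
    ∃ D : p.ProlFiber, ∀ f, D.der (p.germ hp f) = p.eval hp (d f) := by
  let _ : Algebra Γ(V, U) p.Loc := (p.germ hp).toAlgebra
  let _ : Algebra Γ(V, U) K := (p.eval hp).toAlgebra
  have : IsScalarTower Γ(V, U) p.Loc K := .of_algebraMap_eq fun _ => rfl
  have : IsLocalization.AtPrime p.Loc (hU.primeIdealOf ⟨p.pt, hp⟩).asIdeal :=
    hU.isLocalization_stalk ⟨p.pt, hp⟩
  -- The local ring is a localization of K[U], so f ↦ d(f)(p) extends to germs.
  have : Algebra.FormallyEtale Γ(V, U) p.Loc :=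
    .of_isLocalization (hU.primeIdealOf ⟨p.pt, hp⟩).asIdeal.primeCompl
  obtain ⟨D, hD⟩ := ((Algebra.linearMap Γ(V, U) K).compDer d).exists_extension_of_formallyEtale
    (B := p.Loc)
  refine ⟨⟨D, fun c => ?_⟩, hD⟩
  rw [← germ_algebraMap hp c]
  refine (hD _).trans ?_
  change p.eval hp (d _) = _
  rw [hd, eval_algebraMap]

end KPoint

end TauForms

end

/-! ### Regular τ-forms on affine open sets -/

noncomputable section

namespace TauForms

open CategoryTheory Opposite KaehlerDifferential
open scoped Differential

attribute [local instance] constAlgebra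

variable {K : Type u} [Field K] {V : Scheme.{u}} [V.Over (Spec (.of K))] [Differential K]

/-- The value of an element of `Ψ[U]` at an element of the prolongation. -/
def Psi.evalAt {U : V.Opens} (p : KPoint K V) (hp : p.pt ∈ U) (D : p.ProlFiber) :
    Psi K U →ₛₗ[p.eval hp] K where
  toFun ψ := (ψ ⟨p, hp⟩).1 D
  map_add' _ _ := rfl
  map_smul' _ _ := rfl

theorem Psi.ext_evalAt {U : V.Opens} {ψ φ : Psi K U}
    (h : ∀ p hp D, Psi.evalAt p hp D ψ = Psi.evalAt p hp D φ) : ψ = φ :=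
  funext fun p => Subtype.ext (funext fun D => h p.1 p.2 D)

variable (K) in
/-- `τ` is a derivation from `K[U]` to `Ψ[U]`. -/
def tauDer (U : V.Opens) : Derivation ℤ Γ(V, U) (Psi K U) :=
  .mk' (AddMonoidHom.toIntLinearMap
    { toFun := tauDiff K U
      map_zero' := Psi.ext_evalAt fun p hp D =>
        (congrArg D.der (map_zero (p.germ hp))).trans (map_zero D.der)
      map_add' := fun f g => Psi.ext_evalAt fun p hp D =>
        (congrArg D.der (map_add (p.germ hp) f g)).trans (map_add D.der _ _) })
    fun f g => Psi.ext_evalAt fun p hp D =>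
      (congrArg D.der (map_mul (p.germ hp) f g)).trans (D.der.leibniz _ _)

variable (K) in
theorem tauDer_apply (U : V.Opens) (f : Γ(V, U)) : tauDer K U f = tauDiff K U f := rfl

variable (K) in
/-- The constant function `1`. -/
def Psi.one (U : V.Opens) : Psi K U := fun _ => ⟨fun _ => 1, 0, fun _ _ => (zero_add _).symm⟩

/-- All elements of a fibre of the prolongation restrict to δ on K, so τc is the constant c′. This
is why τ is not K-linear. -/
theorem tauDiff_algebraMap (U : V.Opens) (c : K) :
    tauDiff K U (algebraMap K Γ(V, U) c) = algebraMap K Γ(V, U) (c′) • Psi.one K U :=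
  Psi.ext_evalAt fun p hp D => by
    rw [LinearMap.map_smulₛₗ, p.eval_algebraMap]
    change D.der (p.germ hp _) = _ * 1
    rw [KPoint.germ, germ_algebraMap, D.der_const, mul_one]

theorem one_mem_tauSpan [IsDifferentiallyClosed K] (U : V.Opens) : Psi.one K U ∈ tauSpan K U := by
  obtain ⟨t, ht⟩ := IsDifferentiallyClosed.exists_deriv_eq_one K
  have h := tauDiff_algebraMap U t
  rw [ht, map_one, one_smul] at h
  exact h ▸ Submodule.subset_span ⟨_, rfl⟩

section Presentation

variable {U : V.Opens} (d : Derivation ℤ Γ(V, U) Γ(V, U))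
  (hd : ∀ c : K, d (algebraMap K Γ(V, U) c) = algebraMap K Γ(V, U) (c′))

variable (K U) in
/-- `Ψ[U]` as a vector space over the base field. -/
@[reducible]
def psiModule : Module K (Psi K U) := Module.compHom _ (algebraMap K Γ(V, U))

attribute [local instance] psiModule

instance : IsScalarTower K Γ(V, U) (Psi K U) :=
  .of_algebraMap_smul fun _ _ => rfl

/-- A derivation of `K[U]` which extends the derivation of `K` turns `τ` into a `K`-linear
derivation. -/
def relTauDer : Derivation K Γ(V, U) (Psi K U) :=
  .mk' { toFun := fun f => tauDiff K U f - d f • Psi.one K U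
         map_add' := fun f g => by
          rw [← tauDer_apply, map_add, map_add, add_smul, tauDer_apply, tauDer_apply]; abel
         map_smul' := fun c f => by
          rw [Algebra.smul_def, ← tauDer_apply, Derivation.leibniz, Derivation.leibniz, hd,
            tauDer_apply, tauDer_apply, tauDiff_algebraMap, RingHom.id_apply,
            ← algebraMap_smul Γ(V, U) c]
          module }
    fun f g => by
      change tauDiff K U (f * g) - _ = f • (_ - _) + g • (_ - _)
      rw [← tauDer_apply, Derivation.leibniz, Derivation.leibniz, tauDer_apply, tauDer_apply]
      module

theorem relTauDer_apply (f : Γ(V, U)) :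
    relTauDer d hd f = tauDiff K U f - d f • Psi.one K U := rfl

/-- The map from `Ω_{K[U]/K} × K[U]` to `Ψ[U]` with `(df, g) ↦ τf - d(f) + g`. -/
def presentation : (Ω[Γ(V, U)⁄K] × Γ(V, U)) →ₗ[Γ(V, U)] Psi K U :=
  (relTauDer d hd).liftKaehlerDifferential.coprod (LinearMap.toSpanSingleton _ _ (Psi.one K U))

theorem presentation_apply (ω : Ω[Γ(V, U)⁄K]) (g : Γ(V, U)) : presentation d hd (ω, g) =
    (relTauDer d hd).liftKaehlerDifferential ω + g • Psi.one K U := rfl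

/-- `relTauDer` and τ differ by multiples of `Psi.one`, which lies in `tauSpan` by
`one_mem_tauSpan`; hence both, together with `Psi.one`, generate the same module. -/
theorem range_presentation [IsDifferentiallyClosed K] :
    LinearMap.range (presentation d hd) = tauSpan K U := by
  apply le_antisymm
  · rw [presentation, LinearMap.range_coprod, sup_le_iff]
    constructor
    · rw [LinearMap.range_eq_map, ← span_range_derivation, Submodule.map_span_le]
      rintro _ ⟨f, rfl⟩
      rw [Derivation.liftKaehlerDifferential_comp_D, relTauDer_apply]
      exact sub_mem (Submodule.subset_span ⟨f, rfl⟩) (Submodule.smul_mem _ _ (one_mem_tauSpan U))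
    · rintro _ ⟨g, rfl⟩
      exact Submodule.smul_mem _ _ (one_mem_tauSpan U)
  · rw [tauSpan, Submodule.span_le]
    rintro _ ⟨f, rfl⟩
    refine ⟨(KaehlerDifferential.D K _ f, d f), ?_⟩
    rw [presentation_apply, Derivation.liftKaehlerDifferential_comp_D, relTauDer_apply,
      sub_add_cancel]

/-- For a K-derivation e of K[U], d + e also extends δ and gives a point D of each fibre of the
prolongation. Evaluating the image of (ω, g) at these points yields e(ω) + g, which therefore
vanishes for every e if (ω, g) is in the kernel. The choice e = 0 gives g = 0, and the coordinates
of a basis of Ω_{K[U]/K} give ω = 0. -/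
theorem presentation_injective [IsAlgClosed K] (hU : IsAffineOpen U) [IsReduced Γ(V, U)]
    [Algebra.FiniteType K Γ(V, U)] [Module.Free Γ(V, U) Ω[Γ(V, U)⁄K]] :
    Function.Injective (presentation d hd) := by
  have key (p : KPoint K V) (hp : p.pt ∈ U) (e : Derivation K Γ(V, U) Γ(V, U))
      (D : p.ProlFiber) (hD : ∀ f, D.der (p.germ hp f) = p.eval hp (d f + e f))
      (ω : Ω[Γ(V, U)⁄K]) :
      Psi.evalAt p hp D ((relTauDer d hd).liftKaehlerDifferential ω) =
        p.eval hp (e.liftKaehlerDifferential ω) := by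
    have hω : ω ∈ Submodule.span Γ(V, U) (Set.range (KaehlerDifferential.D K Γ(V, U))) := by
      rw [span_range_derivation]; trivial
    induction hω using Submodule.span_induction with
    | mem ω hω =>
      obtain ⟨f, rfl⟩ := hω
      rw [Derivation.liftKaehlerDifferential_comp_D, Derivation.liftKaehlerDifferential_comp_D,
        relTauDer_apply, map_sub, LinearMap.map_smulₛₗ]
      change D.der (p.germ hp f) - p.eval hp (d f) * 1 = _
      rw [hD, map_add, mul_one, add_sub_cancel_left]
    | zero => simp only [map_zero]
    | add ω η _ _ h₁ h₂ => simp only [map_add, h₁, h₂]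
    | smul g ω _ h₁ =>
      rw [LinearMap.map_smul, LinearMap.map_smul, LinearMap.map_smulₛₗ, h₁, smul_eq_mul, smul_eq_mul,
        map_mul]
  rw [injective_iff_map_eq_zero]
  rintro ⟨ω, g⟩ h
  rw [presentation_apply] at h
  have key' (e : Derivation K Γ(V, U) Γ(V, U)) : e.liftKaehlerDifferential ω + g = 0 := by
    refine KPoint.eq_zero_of_forall_eval_eq_zero (K := K) hU _ fun p hp => ?_
    obtain ⟨D, hD⟩ := p.exists_der_germ_eq hU hp (d + e.restrictScalars ℤ) fun c => by
      rw [Derivation.add_apply, hd, Derivation.restrictScalars_apply, Derivation.map_algebraMap,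
        add_zero]
    have h' := congrArg (Psi.evalAt p hp D) h
    rw [map_add, key p hp e D hD, map_zero, LinearMap.map_smulₛₗ] at h'
    rw [map_add, ← h']
    exact congrArg _ (mul_one _).symm
  have hg : g = 0 := by
    have := key' 0
    rwa [show (0 : Derivation K Γ(V, U) Γ(V, U)).liftKaehlerDifferential = 0 from
      map_zero (KaehlerDifferential.linearMapEquivDerivation K Γ(V, U)).symm,
      LinearMap.zero_apply, zero_add] at this
  subst hg
  refine Prod.ext ?_ rfl
  refine (Module.Free.chooseBasis Γ(V, U) Ω[Γ(V, U)⁄K]).ext_elem fun i => ?_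
  have := key' (((Module.Free.chooseBasis Γ(V, U) Ω[Γ(V, U)⁄K]).coord i).compDer
    (KaehlerDifferential.D K _))
  rw [add_zero, Derivation.liftKaehlerDifferential_unique _ _
    (Derivation.liftKaehlerDifferential_comp _)] at this
  simpa using this

end Presentation

/-- Denominators of elements of `tauSpan K W` on a basic open subset can be cleared. -/
theorem exists_res_eq_pow_smul {U : V.Opens} (hU : IsAffineOpen U) (h : Γ(V, U))
    {θ : Psi K (V.basicOpen h)} (hθ : θ ∈ tauSpan K (V.basicOpen h)) :
    ∃ (n : ℕ), ∃ η ∈ tauSpan K U, Psi.res (V.basicOpen_le h) η =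
      resFun (V.basicOpen_le h) (h ^ n) • θ := by
  have := hU.isLocalization_basicOpen h
  have hfrac (f : Γ(V, V.basicOpen h)) : ∃ (n : ℕ) (a : Γ(V, U)),
      resFun (V.basicOpen_le h) (h ^ n) * f = resFun (V.basicOpen_le h) a := by
    obtain ⟨⟨a, _, n, rfl⟩, hn⟩ := IsLocalization.surj (Submonoid.powers h) f
    exact ⟨n, a, (mul_comm _ _).trans hn⟩
  induction hθ using Submodule.span_induction with
  | mem θ hθ =>
    obtain ⟨f, rfl⟩ := hθ
    obtain ⟨n, a, hn⟩ := hfrac f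
    -- The quotient rule for f = a / hⁿ, multiplied by h²ⁿ.
    refine ⟨n + n, h ^ n • tauDiff K U a - a • tauDiff K U (h ^ n),
      sub_mem (Submodule.smul_mem _ _ (Submodule.subset_span ⟨_, rfl⟩))
        (Submodule.smul_mem _ _ (Submodule.subset_span ⟨_, rfl⟩)), ?_⟩
    rw [map_sub, LinearMap.map_smulₛₗ, LinearMap.map_smulₛₗ, res_tauDiff, res_tauDiff, ← hn,
      ← tauDer_apply, Derivation.leibniz, tauDer_apply, tauDer_apply, pow_add, map_mul]
    module
  | zero => exact ⟨0, 0, zero_mem _, by rw [map_zero, smul_zero]⟩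
  | add θ₁ θ₂ _ _ h₁ h₂ =>
    obtain ⟨n₁, η₁, hη₁, e₁⟩ := h₁
    obtain ⟨n₂, η₂, hη₂, e₂⟩ := h₂
    refine ⟨n₁ + n₂, h ^ n₂ • η₁ + h ^ n₁ • η₂,
      add_mem (Submodule.smul_mem _ _ hη₁) (Submodule.smul_mem _ _ hη₂), ?_⟩
    rw [map_add, LinearMap.map_smulₛₗ, LinearMap.map_smulₛₗ, e₁, e₂, pow_add, map_mul]
    module
  | smul g θ _ hθ =>
    obtain ⟨n, η, hη, e⟩ := hθ
    obtain ⟨m, a, hm⟩ := hfrac g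
    refine ⟨m + n, a • η, Submodule.smul_mem _ _ hη, ?_⟩
    rw [LinearMap.map_smulₛₗ, e, ← hm, pow_add, map_mul]
    module

/-- Two elements of `Ψ[U]` which agree on a basic open set agree after multiplication with its
equation. -/
theorem smul_eq_smul_of_res_eq {U : V.Opens} (h : Γ(V, U)) {ψ φ : Psi K U}
    (e : Psi.res (V.basicOpen_le h) ψ = Psi.res (V.basicOpen_le h) φ) : h • ψ = h • φ := by
  funext p
  change p.1.eval p.2 h • ψ p = p.1.eval p.2 h • φ p
  by_cases hp : p.1.pt ∈ V.basicOpen h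
  · exact congrArg _ (congrFun e ⟨p.1, hp⟩)
  -- Outside the basic open set h takes the value 0.
  · rw [p.1.mem_basicOpen_iff p.2, not_not] at hp
    rw [hp, zero_smul, zero_smul]

/-- On an affine open set, the regular `τ`-forms are generated by the `τ`-differentials. -/
theorem tauForm_eq_tauSpan {U : V.Opens} (hU : IsAffineOpen U) : TauForm K U = tauSpan K U := by
  apply le_antisymm
  · intro ψ hψ
    -- I consists of the g with gψ in `tauSpan`. Near the point of a maximal ideal M containing I, ψ
    -- is generated on some basic open set of h ∉ M, which puts a power of h into I.
    let I : Ideal Γ(V, U) := (tauSpan K U).comap (LinearMap.toSpanSingleton _ _ ψ)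
    suffices hI : I = ⊤ by
      have h1 : (1 : Γ(V, U)) ∈ I := hI ▸ trivial
      simpa [I] using h1
    by_contra hI
    obtain ⟨M, hM, hIM⟩ := Ideal.exists_le_maximal I hI
    let m : PrimeSpectrum Γ(V, U) := ⟨M, hM.isPrime⟩
    have hm : hU.fromSpec m ∈ U := by
      rw [← SetLike.mem_coe, ← hU.range_fromSpec]
      exact ⟨_, rfl⟩
    obtain ⟨W, hWU, hmW, hW⟩ := hψ _ hm
    obtain ⟨h, hhW, hmh⟩ := hU.exists_basicOpen_le ⟨_, hmW⟩ hm
    obtain ⟨n, η, hη, e⟩ := exists_res_eq_pow_smul hU h (res_mem_tauSpan hhW hW)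
    have e' : Psi.res (V.basicOpen_le h) η = Psi.res (V.basicOpen_le h) (h ^ n • ψ) :=
      e.trans (LinearMap.map_smulₛₗ (Psi.res (V.basicOpen_le h)) (h ^ n) ψ).symm
    -- η and hⁿψ agree only where h ≠ 0; one more factor h makes them agree on all of U.
    have hmem : h * h ^ n ∈ I := by
      change (h * h ^ n) • ψ ∈ tauSpan K U
      rw [mul_smul, ← smul_eq_smul_of_res_eq h e']
      exact Submodule.smul_mem _ _ hη
    have hhM : h ∈ M := hM.isPrime.mem_of_pow_mem (n + 1) (by rw [pow_succ']; exact hIM hmem)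
    have : m ∈ hU.fromSpec ⁻¹ᵁ V.basicOpen h := hmh
    rw [hU.fromSpec_preimage_basicOpen] at this
    exact this hhM
  · exact fun ψ hψ x hx => ⟨U, le_rfl, hx, hψ⟩

/-- The regular `τ`-forms on a smooth affine open set are `Ω_{K[U]/K} × K[U]`. -/
theorem nonempty_equiv_tauForm [IsDifferentiallyClosed K] {U : V.Opens} (hU : IsAffineOpen U)
    [IsReduced Γ(V, U)] [Algebra.FiniteType K Γ(V, U)] [Algebra.FormallySmooth K Γ(V, U)]
    [Module.Free Γ(V, U) Ω[Γ(V, U)⁄K]] :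
    Nonempty ((Ω[Γ(V, U)⁄K] × Γ(V, U)) ≃ₗ[Γ(V, U)] TauForm K U) := by
  have := IsDifferentiallyClosed.isAlgClosed K
  obtain ⟨d, hd⟩ := Derivation.exists_extension_of_formallySmooth (S := Γ(V, U))
    (Differential.deriv (R := K))
  exact ⟨(LinearEquiv.ofInjective _ (presentation_injective d hd hU)).trans
    (LinearEquiv.ofEq _ _ ((range_presentation d hd).trans (tauForm_eq_tauSpan hU).symm))⟩

end TauForms

end

/-! ### Rational τ-forms over the function field -/

noncomputable section

namespace TauForms

open CategoryTheory Opposite KaehlerDifferential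
open scoped Differential

attribute [local instance] constAlgebra

variable {K : Type u} [Field K] {V : Scheme.{u}} [V.Over (Spec (.of K))]

section RatTauForm

variable [Differential K] [IsIntegral V]

namespace RatTauForm

/-- Rational `τ`-forms as a module over the regular functions on a nonempty open set. -/
@[reducible]
def sectionsModule {U : V.Opens} (hU : (U : Set V).Nonempty) :
    Module Γ(V, U) (RatTauForm K V) := Module.compHom _ (ratFun hU)

/-- A regular `τ`-form on an affine open set is determined by the rational `τ`-form which it gives,
if the regular `τ`-forms are torsion-free. -/
theorem mk_injective {U : V.Opens} (hU : (U : Set V).Nonempty) (hUa : IsAffineOpen U)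
    [Module.IsTorsionFree Γ(V, U) (TauForm K U)] :
    Function.Injective (mk (K := K) hU) := by
  intro ω η h
  obtain ⟨W, hWU, _, ⟨x, hx⟩, e⟩ := Quotient.exact h
  obtain ⟨f, hfW, hxf⟩ := hUa.exists_basicOpen_le ⟨x, hx⟩ (hWU hx)
  have hf : f ≠ 0 := by
    rintro rfl
    rw [Scheme.basicOpen_zero] at hxf
    exact hxf
  have : Nonempty U := ⟨⟨x, hWU hx⟩⟩
  -- Forms agreeing where f ≠ 0 become equal after multiplication by f, which torsion-freeness
  -- cancels.
  refine smul_right_injective (TauForm K U) hf (Subtype.ext ?_)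
  exact smul_eq_smul_of_res_eq f (congrArg (fun θ : TauForm K W => Psi.res hfW θ.1) e)

/-- A rational form is generated by τ-differentials on some basic open set of U; multiplied by a
power of its equation f it comes from U, and f is invertible in K(V). -/
theorem span_range_mk {U : V.Opens} (hU : (U : Set V).Nonempty) (hUa : IsAffineOpen U) :
    Submodule.span V.functionField (Set.range (mk (K := K) hU)) = ⊤ := by
  rw [eq_top_iff]
  rintro a -
  obtain ⟨W, ⟨x, hx⟩, hWU, ω, rfl⟩ := exists_rep_on a hU
  obtain ⟨W', hW'W, hx', hω⟩ := ω.2 x hx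
  obtain ⟨f, hf, hxf⟩ := hUa.exists_basicOpen_le ⟨x, hx'⟩ (hWU hx)
  have hne : ((V.basicOpen f : V.Opens) : Set V).Nonempty := ⟨x, hxf⟩
  obtain ⟨n, η, hη, e⟩ := exists_res_eq_pow_smul hUa f (res_mem_tauSpan hf hω)
  have hη' : η ∈ TauForm K U := fun y hy => ⟨U, le_rfl, hy, hη⟩
  have h : mk hU ⟨η, hη'⟩ = ratFun hU (f ^ n) • mk ⟨x, hx⟩ ω := by
    rw [← mk_res hU hne (V.basicOpen_le f), ← ratFun_res hU hne (V.basicOpen_le f),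
      ← mk_res ⟨x, hx⟩ hne (hf.trans hW'W), ratFun_smul_mk]
    exact congrArg (mk hne) (Subtype.ext e)
  have hf0 : ratFun hU (f ^ n) ≠ 0 := by
    rw [map_pow]
    refine pow_ne_zero n fun h0 => ?_
    have hf' : f = 0 := germ_injective_of_isIntegral _ _ (genericPoint_mem hU)
      (h0.trans (map_zero _).symm)
    rw [hf', Scheme.basicOpen_zero] at hxf
    exact hxf
  have h2 : mk ⟨x, hx⟩ ω = (ratFun hU (f ^ n))⁻¹ • mk hU ⟨η, hη'⟩ := by
    rw [h, ← mul_smul, inv_mul_cancel₀ hf0, one_smul]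
  rw [h2]
  exact Submodule.smul_mem _ _ (Submodule.subset_span ⟨_, rfl⟩)

/-- A basis over K[U] maps to a basis over K(V): `mk_injective` and passage to the fraction field
give independence, `span_range_mk` gives spanning. -/
theorem finrank_eq {U : V.Opens} (hU : (U : Set V).Nonempty) (hUa : IsAffineOpen U)
    [Module.Free Γ(V, U) (TauForm K U)] :
    Module.finrank V.functionField (RatTauForm K V) = Module.finrank Γ(V, U) (TauForm K U) := by
  have : Nonempty U := hU.to_subtype
  have := functionField_isFractionRing_of_isAffineOpen V U hUa
  let _ : Module Γ(V, U) (RatTauForm K V) := sectionsModule hU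
  have : IsScalarTower Γ(V, U) V.functionField (RatTauForm K V) :=
    .of_algebraMap_smul fun _ _ => rfl
  let m : TauForm K U →ₗ[Γ(V, U)] RatTauForm K V :=
    { toFun := mk hU
      map_add' := fun ω η => (mk_add_mk hU ω η).symm
      map_smul' := fun g ω => (ratFun_smul_mk hU g ω).symm }
  let b := Module.Free.chooseBasis Γ(V, U) (TauForm K U)
  have hli : LinearIndependent V.functionField (m ∘ b) :=
    (LinearIndependent.iff_fractionRing Γ(V, U) V.functionField).mp
      (b.linearIndependent.map' m (LinearMap.ker_eq_bot.mpr (mk_injective hU hUa)))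
  have hspan : ⊤ ≤ Submodule.span V.functionField (Set.range (m ∘ b)) := by
    rw [← span_range_mk hU hUa, Submodule.span_le]
    rintro _ ⟨ω, rfl⟩
    change m ω ∈ _
    have h : ω ∈ Submodule.span Γ(V, U) (Set.range b) := b.span_eq ▸ trivial
    have h' := Submodule.mem_map_of_mem (f := m) h
    rw [Submodule.map_span, ← Set.range_comp] at h'
    exact Submodule.span_le_restrictScalars Γ(V, U) V.functionField _ h'
  rw [Module.finrank_eq_nat_card_basis (Module.Basis.mk hli hspan),
    Module.finrank_eq_nat_card_basis b]

end RatTauForm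

end RatTauForm

/-! ### The dimension of V as the rank of differentials -/

section Dimension

/-- The dimension of a topological space is the supremum of the dimensions of open sets which
cover it. -/
theorem _root_.topologicalKrullDim_eq_of_isOpenCover {X : Type*} [TopologicalSpace X] [Nonempty X]
    {d : WithBot ℕ∞}
    (h : ∀ x : X, ∃ U : TopologicalSpace.Opens X, x ∈ U ∧ topologicalKrullDim U = d) :
    topologicalKrullDim X = d := by
  obtain ⟨U, -, hU⟩ := h (Classical.arbitrary X)
  refine le_antisymm ?_ (hU ▸ topologicalKrullDim_subspace_le X U)
  -- The coheight of an irreducible closed set is unchanged by intersecting with an open set that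
  -- meets it, hence is at most the dimension of that open set.
  rw [topologicalKrullDim, Order.krullDim_eq_iSup_coheight]
  refine iSup_le fun Z => ?_
  obtain ⟨z, hz⟩ := Z.isIrreducible.nonempty
  obtain ⟨U, hzU, hU⟩ := h z
  let e := TopologicalSpace.IrreducibleCloseds.orderIsoOfIsOpenEmbedding _
    U.isOpen.isOpenEmbedding_subtypeVal
  let Z' : {Z : TopologicalSpace.IrreducibleCloseds X |
    ((Subtype.val : U → X) ⁻¹' Z).Nonempty} := ⟨Z, ⟨⟨z, hzU⟩, hz⟩⟩
  have hZ : TopologicalSpace.IrreducibleCloseds.map _ continuous_subtype_val (e.symm Z') = Z :=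
    congrArg Subtype.val (e.apply_symm_apply Z')
  rw [← hZ, U.isOpen.isOpenEmbedding_subtypeVal.coheight_map, ← hU]
  exact Order.coheight_le_krullDim _

variable [Smooth (V ↘ Spec (.of K))]

theorem algebraSmooth {U : V.Opens} (hU : IsAffineOpen U) : Algebra.Smooth K Γ(V, U) := by
  have h := (V ↘ Spec (.of K)).smooth_appLE (isAffineOpen_top _) hU le_top
  exact RingHom.Smooth.respectsIso.2 _ (Scheme.ΓSpecIso (.of K)).symm.commRingCatIsoToRingEquiv h

/-- Every point has an affine neighbourhood which is standard smooth over the base field. -/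
theorem exists_isStandardSmooth (x : V) : ∃ U : V.Opens, x ∈ U ∧ IsAffineOpen U ∧
    Algebra.IsStandardSmooth K Γ(V, U) := by
  obtain ⟨O, hO, U, hU, hx, e, h⟩ := Smooth.exists_isStandardSmooth (V ↘ Spec (.of K)) x
  refine ⟨U, hx, hU, ?_⟩
  -- Spec K has a single point.
  obtain rfl : O = ⊤ := by
    have : Subsingleton (Spec (CommRingCat.of K)) :=
      inferInstanceAs (Subsingleton (PrimeSpectrum K))
    exact top_unique fun y _ => Subsingleton.elim ((V ↘ Spec (.of K)) x) y ▸ e hx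
  exact RingHom.isStandardSmooth_respectsIso.2 _
    (Scheme.ΓSpecIso (.of K)).symm.commRingCatIsoToRingEquiv h

variable [IsIntegral V] [CharZero K]

variable (K V) in
/-- The function field is an algebra over the base field. -/
@[reducible]
def functionFieldAlgebra : Algebra K V.functionField := (constGerm K (genericPoint V)).toAlgebra

attribute [local instance] functionFieldAlgebra

instance isScalarTower_functionField (U : V.Opens) [Nonempty U] :
    IsScalarTower K Γ(V, U) V.functionField :=
  .of_algebraMap_eq fun c => (germ_algebraMap _ c).symm

/-- The right-hand side does not depend on U, so these local dimensions determine that of V. -/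
theorem topologicalKrullDim_affineOpen {U : V.Opens} (hU : IsAffineOpen U) [Nonempty U] :
    topologicalKrullDim U = Module.finrank V.functionField Ω[V.functionField⁄K] := by
  have := algebraSmooth (K := K) hU
  have := functionField_isFractionRing_of_isAffineOpen V U hU
  rw [← ringKrullDim_eq_finrank_kaehlerDifferential K Γ(V, U) V.functionField,
    ← PrimeSpectrum.topologicalKrullDim_eq_ringKrullDim]
  exact IsHomeomorph.topologicalKrullDim_eq _ hU.isoSpec.hom.homeomorph.isHomeomorph

variable (K V) in
theorem topologicalKrullDim_eq_finrank :
    topologicalKrullDim V = Module.finrank V.functionField Ω[V.functionField⁄K] := by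
  refine topologicalKrullDim_eq_of_isOpenCover fun x => ?_
  obtain ⟨U, hU, hx, -⟩ := exists_isAffineOpen_mem_and_subset (x := x) (U := ⊤) trivial
  have : Nonempty U := ⟨⟨x, hx⟩⟩
  exact ⟨U, hx, topologicalKrullDim_affineOpen hU⟩

end Dimension

end TauForms

end

-- Standard smoothness makes Ω_{K[U]/K} free of finite rank, and comparison at the generic point
-- shows that this rank is n. The summand K[U], spanned by the constant form 1, accounts for the
-- additional 1.
attribute [local instance] TauForms.constAlgebra TauForms.functionFieldAlgebra in
theorem TauForms.exists_free_finrank_tauForm (K : Type u) [Field K] [Differential K]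
    [TauForms.IsDifferentiallyClosed K]
    (V : Scheme.{u}) [V.Over (Spec (.of K))] [IsIntegral V] [Smooth (V ↘ Spec (.of K))]
    (n : ℕ) (hn : topologicalKrullDim V = n) (x : V) :
    ∃ U : V.Opens, x ∈ U ∧ IsAffineOpen U ∧
      Module.Free Γ(V, U) (TauForms.TauForm K U) ∧
      Module.Finite Γ(V, U) (TauForms.TauForm K U) ∧
      Module.finrank Γ(V, U) (TauForms.TauForm K U) = n + 1 := by
  obtain ⟨U, hx, hU, _⟩ := TauForms.exists_isStandardSmooth (K := K) x
  have : Nonempty U := ⟨⟨x, hx⟩⟩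
  obtain ⟨e⟩ := TauForms.nonempty_equiv_tauForm (K := K) hU
  have := functionField_isFractionRing_of_isAffineOpen V U hU
  have hrank : Module.finrank Γ(V, U) Ω[Γ(V, U)⁄K] = n := by
    rw [TauForms.topologicalKrullDim_eq_finrank K V] at hn
    rw [← finrank_kaehlerDifferential_of_isFractionRing K Γ(V, U) V.functionField]
    exact_mod_cast hn
  refine ⟨U, hx, hU, .of_equiv e, .equiv e, ?_⟩
  rw [← e.finrank_eq, Module.finrank_prod, hrank, Module.finrank_self]

theorem mainTheorem4 (K : Type u) [Field K] [Differential K] [TauForms.IsDifferentiallyClosed K]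
    (V : Scheme.{u}) [V.Over (Spec (.of K))] [IsIntegral V]
    [IsSeparated (V ↘ Spec (.of K))] [QuasiCompact (V ↘ Spec (.of K))]
    [Smooth (V ↘ Spec (.of K))]
    (n : ℕ) (hn : topologicalKrullDim V = n) :
    (∀ x : V, ∃ U : V.Opens, x ∈ U ∧ IsAffineOpen U ∧
      Module.Free Γ(V, U) (TauForms.TauForm K U) ∧
      Module.Finite Γ(V, U) (TauForms.TauForm K U) ∧
      Module.finrank Γ(V, U) (TauForms.TauForm K U) = n + 1) ∧
    Module.finrank V.functionField (TauForms.RatTauForm K V) = n + 1 := by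
  have h := TauForms.exists_free_finrank_tauForm K V n hn
  refine ⟨h, ?_⟩
  obtain ⟨U, hx, hU, _, -, hrank⟩ := h (genericPoint V)
  rw [TauForms.RatTauForm.finrank_eq ⟨_, hx⟩ hU, hrank]
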